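/- \textbf{Proposition 5.2.} \emph{Decompositions.} To split an open interval $(a,b)$ with arity $p\ge 2$ means to replace it by the $p$ intervals $\left(a+\tfrac{j}{p}(b-a),\,a+\tfrac{j+1}{p}(b-a)\right)$, $0\le j<p$. Let $\mathcal S_{1,n}$ be the set of all sets of exactly $n$ open intervals that can be obtained from $\{(0,1)\}$ by a finite (possibly empty) sequence of splittings of single members, with arbitrary arities $\ge 2$. For $r\ge 1$ let $D_r=\{(\tfrac jr,\tfrac{j+1}r):0\le j<r\}$. For $S\in\mathcal S_{1,n}$, let $\gcd(S)$ be the largest $r\ge1$ such that $S$ can be obtained from $D_r$ by a (possibly empty) sequence of splittings. \emph{Covering systems.} Write $\langle a\rangle_m=\{x\in\mathbb Z: x\equiv a \bmod m\}$. Let $\mathcal C_n$ be the set of natural exact covering systems with exactly $n$ residue classes, i.e. of the sets of $n$ residue classes that can be obtained from $\{\langle 0\rangle_1\}$ by finitely many operations, each replacing one class $\langle a\rangle_m$ by the $r$ classes $\langle im+a\rangle_{rm}$, $0\le i<r$, for some $r\ge2$. For $C\in\mathcal C_n$ let $\gcd(C)$ be the greatest common divisor of the moduli of its classes. \emph{The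 map.} Define $\Phi$ recursively by $\Phi(\{(0,1)\})=\{\langle 0\rangle_1\}$ and, for $S\in\mathcal S_{1,n}$ with $n\ge2$ and $r=\gcd(S)$, \[ \Phi(S)=\bigcup_{j=0}^{r-1}\left\{\langle ra+j\rangle_{rm} : \langle a\rangle_m\in\Phi(S_j)\right\}, \qquad S_j=\left\{\, rR-j : R\in S,\ R\subseteq\left(\tfrac jr,\tfrac{j+1}r\right)\right\}, \] where $rR-j=\{rx-j:x\in R\}$. \emph{Claim.} For every integer $n\ge1$, $\Phi$ maps $\mathcal S_{1,n}$ into $\mathcal C_n$ and $\Phi:\mathcal S_{1,n}\to\mathcal C_n$ is a bijection. Moreover, $\gcd(S)$ exists and $\gcd(\Phi(S))=\gcd(S)$ for every $S\in\mathcal S_{1,n}$. -/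

import Mathlib

namespace IntervalNECS

/-! ### Decompositions of the unit interval -/

/-- The set of the `p` open intervals obtained by splitting `(a, b)` into `p` equal parts. -/
def equalParts (a b : ℝ) (p : ℕ) : Set (Set ℝ) :=
  {R | ∃ j : ℕ, j < p ∧
    R = Set.Ioo (a + (j : ℝ) / p * (b - a)) (a + ((j : ℝ) + 1) / p * (b - a))}

/-- `S'` arises from `S` by one splitting operation: one interval `(a, b)` of `S` is replaced by
its `p ≥ 2` equal parts. -/
def SplitStep (S S' : Set (Set ℝ)) : Prop :=
  ∃ (a b : ℝ) (p : ℕ), a < b ∧ 2 ≤ p ∧ Set.Ioo a b ∈ S ∧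
    S' = (S \ {Set.Ioo a b}) ∪ equalParts a b p

/-- `Refines S' S`: `S'` is obtained from `S` by a (possibly empty) sequence of splitting
operations. -/
def Refines (S' S : Set (Set ℝ)) : Prop :=
  Relation.ReflTransGen SplitStep S S'

/-- The interval decompositions: everything obtained from `{(0, 1)}` by splitting operations. -/
def IsDecomposition (S : Set (Set ℝ)) : Prop :=
  Refines S {Set.Ioo 0 1}

/-- The interval decompositions with exactly `n` parts. -/
def decompositions (n : ℕ) : Set (Set (Set ℝ)) :=
  {S | IsDecomposition S ∧ S.ncard = n}

/-- The decomposition of `(0, 1)` into `r` equal parts. -/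
def equalDecomposition (r : ℕ) : Set (Set ℝ) :=
  equalParts 0 1 r

/-- `r` is the gcd of `S`: `S` refines the decomposition into `r` equal parts, and this holds for
no larger number in place of `r`. -/
def IsDecompositionGcd (S : Set (Set ℝ)) (r : ℕ) : Prop :=
  1 ≤ r ∧ Refines S (equalDecomposition r) ∧
    ∀ r' : ℕ, r < r' → ¬ Refines S (equalDecomposition r')

/-- The image of `R` under the increasing affine map that sends `(a, b)` onto `(a', b')`. -/
def scale (a b a' b' : ℝ) (R : Set ℝ) : Set ℝ :=
  (fun x : ℝ => a' + (b' - a') / (b - a) * (x - a)) '' R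

/-- The intervals of `S` inside `(j / r, (j + 1) / r)`, rescaled to `(0, 1)`. -/
def piece (S : Set (Set ℝ)) (r j : ℕ) : Set (Set ℝ) :=
  scale ((j : ℝ) / r) (((j : ℝ) + 1) / r) 0 1 ''
    {R | R ∈ S ∧ R ⊆ Set.Ioo ((j : ℝ) / r) (((j : ℝ) + 1) / r)}

/-! ### Natural exact covering systems -/

/-- The residue class of `a` modulo `n`. -/
def resClass (a : ℤ) (n : ℕ) : Set ℤ :=
  {x | x ≡ a [ZMOD (n : ℤ)]}

/-- One residue class `a mod n` of `C` is replaced by the `r ≥ 2` classes `i n + a mod r n`,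
`0 ≤ i < r`. -/
def NECSStep (C C' : Set (Set ℤ)) : Prop :=
  ∃ (a : ℤ) (n r : ℕ), 1 ≤ n ∧ 2 ≤ r ∧ resClass a n ∈ C ∧
    C' = (C \ {resClass a n}) ∪ {T | ∃ i : ℕ, i < r ∧ T = resClass ((i : ℤ) * n + a) (r * n)}

/-- Natural exact covering systems: everything obtained from `{0 mod 1}` by splitting classes. -/
def IsNECS (C : Set (Set ℤ)) : Prop :=
  Relation.ReflTransGen NECSStep {resClass 0 1} C

/-- The natural exact covering systems with exactly `n` residue classes. -/
def necs (n : ℕ) : Set (Set (Set ℤ)) :=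
  {C | IsNECS C ∧ C.ncard = n}

/-- `r` is the greatest common divisor of the moduli of the residue classes in `C`. -/
def IsNECSGcd (C : Set (Set ℤ)) (r : ℕ) : Prop :=
  (∀ (a : ℤ) (n : ℕ), 1 ≤ n → resClass a n ∈ C → r ∣ n) ∧
    ∀ d : ℕ, (∀ (a : ℤ) (n : ℕ), 1 ≤ n → resClass a n ∈ C → d ∣ n) → d ∣ r

/-- The map `x ↦ r x + j` applied to a set of integers; it places a copy of a subset of `ℤ` inside
the residue class `j mod r`. -/
def embedClass (j r : ℕ) (T : Set ℤ) : Set ℤ :=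
  (fun x : ℤ => (r : ℤ) * x + j) '' T

/-- On residue classes, `embedClass j r` sends `a mod n` to `r a + j mod r n`. -/
theorem embedClass_resClass (j r : ℕ) (hr : 1 ≤ r) (a : ℤ) (n : ℕ) :
    embedClass j r (resClass a n) = resClass ((r : ℤ) * a + j) (r * n) := by
  have hr0 : (r : ℤ) ≠ 0 := by exact_mod_cast (by omega : r ≠ 0)
  ext x
  simp only [embedClass, resClass, Set.mem_image, Set.mem_ofPred_eq]
  constructor
  · rintro ⟨y, hy, rfl⟩
    push_cast
    exact (Int.ModEq.mul_left' hy).add_right _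
  · intro hx
    push_cast at hx
    obtain ⟨k, hk⟩ := hx.dvd
    refine ⟨a - n * k, ?_, by linear_combination hk⟩
    exact (Int.modEq_iff_dvd.2 ⟨k, by ring⟩)

/-! ### Facts that make the recursion for `Phi` terminate -/

theorem refines_equalDecomposition {S : Set (Set ℝ)} {r : ℕ} (hr : 1 ≤ r)
    (h : Refines S (equalDecomposition r)) :
    S.Finite ∧ ∀ j : ℕ, j < r →
      ∃ R ∈ S, R.Nonempty ∧ R ⊆ Set.Ioo ((j : ℝ) / r) (((j : ℝ) + 1) / r) := by
  have hfin : ∀ (a b : ℝ) (p : ℕ), (equalParts a b p).Finite := by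
    intro a b p
    refine ((Set.finite_Iio p).image (fun j : ℕ =>
      Set.Ioo (a + (j : ℝ) / p * (b - a)) (a + ((j : ℝ) + 1) / p * (b - a)))).subset ?_
    rintro R ⟨j, hj, rfl⟩
    exact ⟨j, hj, rfl⟩
  have hr' : (0 : ℝ) < r := by exact_mod_cast hr
  unfold Refines at h
  induction h with
  | refl =>
    refine ⟨hfin _ _ _, fun j hj => ?_⟩
    refine ⟨Set.Ioo ((j : ℝ) / r) (((j : ℝ) + 1) / r), ⟨j, hj, by simp⟩, ?_, subset_rfl⟩
    exact Set.nonempty_Ioo.2 (by gcongr; linarith)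
  | tail _ hstep ih =>
    obtain ⟨a, b, p, hab, hp, -, rfl⟩ := hstep
    obtain ⟨hf, hw⟩ := ih
    refine ⟨(hf.subset Set.sdiff_subset).union (hfin _ _ _), fun j hj => ?_⟩
    obtain ⟨R, hR, hne, hsub⟩ := hw j hj
    by_cases hRab : R = Set.Ioo a b
    · subst hRab
      have hp0 : (0 : ℝ) < p := by exact_mod_cast (by omega : 0 < p)
      have hp1 : (1 : ℝ) / p ≤ 1 := by
        rw [div_le_one hp0]; exact_mod_cast (by omega : 1 ≤ p)
      have hp2 : (0 : ℝ) < 1 / p := by positivity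
      refine ⟨Set.Ioo a (a + 1 / p * (b - a)), Or.inr ⟨0, by omega, by simp⟩, ?_, ?_⟩
      · exact Set.nonempty_Ioo.2 (by nlinarith)
      · exact (Set.Ioo_subset_Ioo le_rfl (by nlinarith)).trans hsub
    · exact ⟨R, Or.inl ⟨hR, hRab⟩, hne, hsub⟩

theorem two_le_of_isDecompositionGcd {S : Set (Set ℝ)} {r : ℕ} (hS : 2 ≤ S.ncard)
    (h : IsDecompositionGcd S r) : 2 ≤ r := by
  obtain ⟨h1, h2, h3⟩ := h
  by_contra hlt
  obtain rfl : r = 1 := by omega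
  have hD : equalDecomposition 1 = {Set.Ioo 0 1} := by
    ext R; simp [equalDecomposition, equalParts]
  rw [hD] at h2
  rcases Relation.ReflTransGen.cases_head h2 with h | ⟨S', ⟨a, b, p, hab, hp, hR, rfl⟩, h⟩
  · rw [← h, Set.ncard_singleton] at hS
    omega
  · rw [Set.mem_singleton_iff] at hR
    obtain rfl : a = 0 := by
      rw [← csInf_Ioo hab, hR, csInf_Ioo one_pos]
    obtain rfl : b = 1 := by
      rw [← csSup_Ioo hab, hR, csSup_Ioo one_pos]
    exact h3 p (by omega) (by simpa [Refines, equalDecomposition] using h)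

theorem ncard_piece_lt {S : Set (Set ℝ)} {r j : ℕ} (hS : 2 ≤ S.ncard)
    (h : IsDecompositionGcd S r) (hj : j < r) : (piece S r j).ncard < S.ncard := by
  have hr := two_le_of_isDecompositionGcd hS h
  obtain ⟨hf, hw⟩ := refines_equalDecomposition h.1 h.2.1
  have hr' : (0 : ℝ) < r := by exact_mod_cast h.1
  obtain ⟨k, hk, hkj⟩ : ∃ k < r, k ≠ j := by
    rcases Nat.eq_zero_or_pos j with rfl | hj0
    · exact ⟨1, by omega, by omega⟩
    · exact ⟨0, by omega, by omega⟩
  obtain ⟨R, hR, ⟨x, hx⟩, hsub⟩ := hw k hk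
  refine (Set.ncard_image_le (hf.subset fun _ h => h.1)).trans_lt
    (Set.ncard_lt_ncard ⟨fun _ h => h.1, fun hall => ?_⟩ hf)
  obtain ⟨h1, h2⟩ := hsub hx
  obtain ⟨h3, h4⟩ := (hall hR).2 hx
  rw [div_lt_iff₀ hr'] at h1 h3
  rw [lt_div_iff₀ hr'] at h2 h4
  have h5 : (k : ℝ) < j + 1 := by linarith
  have h6 : (j : ℝ) < k + 1 := by linarith
  norm_cast at h5 h6
  omega

/-! ### The map from decompositions to covering systems -/

open Classical in
/-- A decomposition with one part is sent to `{0 mod 1}`. A decomposition `S` with at least two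
parts and gcd `r` is cut into its `r` pieces, which are mapped recursively; the `j`-th image is
placed inside the residue class `j mod r`. (The value `{0 mod 1}` is also given to those sets of
sets of reals that have no gcd; no decomposition is among these.) -/
noncomputable def Phi (S : Set (Set ℝ)) : Set (Set ℤ) :=
  if h : 2 ≤ S.ncard ∧ ∃ r, IsDecompositionGcd S r then
    ⋃ j : Fin h.2.choose, embedClass j h.2.choose '' Phi (piece S h.2.choose j)
  else {resClass 0 1}
termination_by S.ncard
decreasing_by exact ncard_piece_lt h.1 h.2.choose_spec j.2

theorem Phi_trivial : Phi {Set.Ioo 0 1} = {resClass 0 1} := by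
  rw [Phi, dif_neg]
  rintro ⟨h, -⟩
  rw [Set.ncard_singleton] at h
  omega

theorem Phi_eq {S : Set (Set ℝ)} {r : ℕ} (hS : 2 ≤ S.ncard) (h : IsDecompositionGcd S r) :
    Phi S = ⋃ j : Fin r, embedClass j r '' Phi (piece S r j) := by
  have hex : 2 ≤ S.ncard ∧ ∃ r, IsDecompositionGcd S r := ⟨hS, r, h⟩
  have hr : hex.2.choose = r := by
    have hc := hex.2.choose_spec
    rcases lt_trichotomy hex.2.choose r with hlt | heq | hlt
    · exact absurd h.2.1 (hc.2.2 _ hlt)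
    · exact heq
    · exact absurd hc.2.1 (h.2.2 _ hlt)
  rw [Phi, dif_pos hex, hr]

end IntervalNECS

/-! Intervals `(a/m, (a+1)/m)` and classes `a mod m` with `a < m` are coded by the pair of degree
`m` and index `a`. Placing one cell inside another multiplies degrees. The two products order the
digits of the index oppositely, but both satisfy the axioms of `CellMonoid`, from which the
combinatorics follows.

The central fact is `refines_level_iff`: a decomposition arises from level `r` by splittings exactly
when `r` divides all its degrees. So the largest `r` for which `S` refines `D_r` is the gcd of the
degrees, the same quantity as for covering systems, and it is at least 2 unless the decomposition is
trivial. The substance is `Dec.quot`: whatever cut a decomposition was built from, divisibility by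
`r` makes every block over level `r` a decomposition.

A decomposition is thus determined by its gcd `r` and its `r` blocks. `Corr` matches decompositions
over two monoids by equal gcd and recursively matched blocks. It is symmetric, single-valued
(`Corr.right_unique`) and total (`Dec.exists_corr`), hence a bijection, and it preserves cardinality
and gcd. Arbitrary blocks may glue to a gcd larger than `r`; matched ones do not, since the gcd of
the whole can be read off from divisibility in the blocks (`forall_dvd_iff_quot`). Finally `Phi`
follows the recursion of `Corr` (`Phi_image_of_corr`). -/

namespace IntervalNECS

/-! ### Abstract cells

Intervals `(a / m, (a + 1) / m)` and residue classes `a mod m` with `a < m` both form a graded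
monoid under substitution of a cell into another one. Splitting a cell into `p` parts means
multiplying it on the right by all cells of degree `p`. -/

/-- A monoid whose elements are determined by a degree `m` and an index `a < m`, such that the
degree is multiplicative and every factorization of the degree lifts to a unique factorization. -/
class CellMonoid (M : Type*) extends Monoid M where
  deg : M → ℕ
  idx : M → ℕ
  ofIdx : ∀ m a : ℕ, a < m → M
  idx_lt : ∀ x, idx x < deg x
  deg_ofIdx : ∀ m a h, deg (ofIdx m a h) = m
  idx_ofIdx : ∀ m a h, idx (ofIdx m a h) = a
  ext_deg_idx : ∀ x y, deg x = deg y → idx x = idx y → x = y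
  deg_mul : ∀ x y, deg (x * y) = deg x * deg y
  exists_factor : ∀ x r, r ∣ deg x → ∃ y z, deg y = r ∧ y * z = x
  factor_unique : ∀ y z y' z', deg y = deg y' → y * z = y' * z' → y = y' ∧ z = z'

namespace CellMonoid

variable {M N : Type*} [CellMonoid M] [CellMonoid N]

theorem deg_pos (x : M) : 0 < deg x := (Nat.zero_le _).trans_lt (idx_lt x)

@[simp] theorem deg_one : deg (1 : M) = 1 := by
  have h := deg_mul (1 : M) 1
  rw [mul_one] at h
  exact Nat.eq_of_mul_eq_mul_left (deg_pos (1 : M)) (by omega)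

theorem eq_one_of_deg {x : M} (h : deg x = 1) : x = 1 := by
  refine ext_deg_idx _ _ (by rw [h, deg_one]) ?_
  have h1 := idx_lt x
  have h2 := idx_lt (1 : M)
  rw [deg_one] at h2
  omega

theorem mul_cancel {u z w : M} (h : u * z = u * w) : z = w := (factor_unique _ _ _ _ rfl h).2

theorem ofIdx_eq {u : M} {r j : ℕ} (hr : deg u = r) (hj : idx u = j) (h : j < r) :
    ofIdx r j h = u :=
  ext_deg_idx _ _ (by rw [deg_ofIdx, hr]) (by rw [idx_ofIdx, hj])

/-- The set of all cells of degree `r`. -/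
def level (M : Type*) [CellMonoid M] (r : ℕ) : Set M := {u | deg u = r}

theorem mem_level {r : ℕ} {u : M} : u ∈ level M r ↔ deg u = r := Iff.rfl

theorem level_one : level M 1 = {1} := by
  ext u
  rw [mem_level, Set.mem_singleton_iff]
  exact ⟨eq_one_of_deg, fun h => h ▸ deg_one⟩

theorem finite_level (r : ℕ) : (level M r).Finite := by
  refine (Set.finite_range fun j : Fin r => (ofIdx r j j.2 : M)).subset ?_
  intro u hu
  rw [mem_level] at hu
  exact ⟨⟨idx u, hu ▸ idx_lt u⟩, ofIdx_eq hu rfl _⟩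

/-- The cells `z` such that `u * z` belongs to `T`. -/
def quot (u : M) (T : Set M) : Set M := {z | u * z ∈ T}

theorem mem_quot {u z : M} {T : Set M} : z ∈ quot u T ↔ u * z ∈ T := Iff.rfl

theorem quot_one (T : Set M) : quot 1 T = T := by
  ext z; rw [mem_quot, one_mul]

theorem quot_quot (u v : M) (T : Set M) : quot v (quot u T) = quot (u * v) T := by
  ext z; rw [mem_quot, mem_quot, mem_quot, mul_assoc]

/-- The set obtained from `T` by splitting its member `x` into `p` parts. -/
def split (T : Set M) (x : M) (p : ℕ) : Set M := (T \ {x}) ∪ (x * ·) '' level M p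

/-- `T'` arises from `T` by splitting one cell into at least two parts. -/
def Step (T T' : Set M) : Prop := ∃ x ∈ T, ∃ p, 2 ≤ p ∧ T' = split T x p

/-- Decompositions of the trivial cell, described recursively from the coarsest cut on. -/
inductive Dec : Set M → Prop
  | root : Dec {1}
  | node (r : ℕ) (T : Set M) (hr : 1 ≤ r) (hdvd : ∀ x ∈ T, r ∣ deg x)
      (h : ∀ u, deg u = r → Dec (quot u T)) : Dec T

/-! ### Recursive decompositions: stability under splitting and passage to blocks -/

theorem quot_split_self (T : Set M) (u z : M) (p : ℕ) :
    quot u (split T (u * z) p) = split (quot u T) z p := by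
  ext w
  simp only [mem_quot, split, Set.mem_union, Set.mem_sdiff, Set.mem_singleton_iff, Set.mem_image]
  refine or_congr (and_congr_right' (not_congr ⟨mul_cancel, fun h => h ▸ rfl⟩)) ?_
  refine exists_congr fun y => and_congr_right' ⟨fun h => ?_, fun h => ?_⟩
  · rw [mul_assoc] at h
    exact mul_cancel h
  · rw [mul_assoc, h]

theorem quot_split_of_ne (T : Set M) {u v : M} (z : M) (p : ℕ) (hd : deg v = deg u)
    (hne : v ≠ u) : quot v (split T (u * z) p) = quot v T := by
  ext w
  simp only [mem_quot, split, Set.mem_union, Set.mem_sdiff, Set.mem_singleton_iff, Set.mem_image]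
  constructor
  · rintro (h | ⟨y, -, h⟩)
    · exact h.1
    · rw [mul_assoc] at h
      exact absurd (factor_unique _ _ _ _ hd h.symm).1 hne
  · exact fun h => Or.inl ⟨h, fun e => hne (factor_unique _ _ _ _ hd e).1⟩

theorem dvd_deg_split {T : Set M} {x : M} {r : ℕ} (p : ℕ) (hx : x ∈ T)
    (h : ∀ x ∈ T, r ∣ deg x) : ∀ y ∈ split T x p, r ∣ deg y := by
  rintro y (hy | ⟨y, -, rfl⟩)
  · exact h y hy.1
  · change r ∣ deg (x * y)
    rw [deg_mul]
    exact (h x hx).mul_right _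

theorem quot_level {r s : ℕ} {u : M} (hu : deg u = r) :
    quot u (level M (r * s)) = level M s := by
  ext z
  rw [mem_quot, mem_level, mem_level, deg_mul, hu]
  exact Nat.mul_right_inj (by have := deg_pos u; omega)

theorem dec_level {r : ℕ} (hr : 1 ≤ r) : Dec (level M r) := by
  refine .node r _ hr (fun x hx => (mem_level.1 hx).symm.dvd) fun u hu => ?_
  have h := quot_level (s := 1) hu
  rw [mul_one, level_one] at h
  rw [h]
  exact .root

/-- A splitting happens inside one block of the coarsest cut and leaves the other blocks unchanged,
so the induction descends into that block. At the root it produces a whole level. -/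
theorem Dec.split {T : Set M} (hT : Dec T) : ∀ {x : M} {p : ℕ}, x ∈ T → 1 ≤ p →
    Dec (split T x p) := by
  induction hT with
  | root =>
    intro x p hx hp
    rw [Set.mem_singleton_iff] at hx
    subst hx
    have : CellMonoid.split {(1 : M)} 1 p = level M p := by
      simp [CellMonoid.split]
    rw [this]
    exact dec_level hp
  | node r T hr hdvd h ih =>
    intro x p hx hp
    refine .node r _ hr (dvd_deg_split p hx hdvd) fun v hv => ?_
    obtain ⟨u, z, hu, rfl⟩ := exists_factor x r (hdvd x hx)
    by_cases hvu : v = u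
    · subst hvu
      rw [quot_split_self]
      exact ih v hu hx hp
    · rw [quot_split_of_ne _ _ _ (hv.trans hu.symm) hvu]
      exact h v hv

/-- A decomposition all of whose degrees are divisible by `r` refines the level `r`. -/
theorem Dec.quot {T : Set M} (hT : Dec T) : ∀ {r : ℕ}, (∀ x ∈ T, r ∣ deg x) →
    ∀ u, deg u = r → Dec (quot u T) := by
  induction hT with
  | root =>
    intro r h u hu
    have h1 := h 1 rfl
    rw [deg_one, Nat.dvd_one] at h1
    rw [eq_one_of_deg (hu.trans h1), quot_one]
    exact .root
  | node p T hp hdvd h ih =>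
    intro r hr u hu
    have hr0 : 0 < r := hu ▸ deg_pos u
    have hg : 0 < Nat.gcd p r := Nat.gcd_pos_of_pos_left _ hp
    -- All degrees are divisible by lcm(p, r) = p · (r/g) = r · (p/g), where g = gcd(p, r). Block
    -- `u` is cut into p/g parts. Each cell `u * t` then has degree lcm(p, r), so it also factors
    -- through a cell `y` of degree `p`, and the induction hypothesis for block `y` applies with
    -- r/g.
    have hdvd' : ∀ x ∈ T, p * (r / Nat.gcd p r) ∣ deg x := fun x hx => by
      rw [← Nat.mul_div_assoc _ (Nat.gcd_dvd_right p r)]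
      exact Nat.lcm_dvd (hdvd x hx) (hr x hx)
    have heq : r * (p / Nat.gcd p r) = p * (r / Nat.gcd p r) := by
      rw [← Nat.mul_div_assoc _ (Nat.gcd_dvd_left p r),
        ← Nat.mul_div_assoc _ (Nat.gcd_dvd_right p r), mul_comm]
    refine .node (p / Nat.gcd p r) _ (Nat.div_pos (Nat.gcd_le_left _ hp) hg) ?_ ?_
    · intro z hz
      have h1 := hdvd' _ (mem_quot.1 hz)
      rw [← heq, deg_mul, hu] at h1
      exact Nat.dvd_of_mul_dvd_mul_left hr0 h1
    · intro t ht
      rw [quot_quot]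
      obtain ⟨y, w, hy, hyw⟩ := exists_factor (u * t) p
        (by rw [deg_mul, hu, ht, heq]; exact dvd_mul_right _ _)
      have hw : deg w = r / Nat.gcd p r := by
        have h2 := congrArg deg hyw
        rw [deg_mul, deg_mul, hy, hu, ht, heq] at h2
        exact Nat.eq_of_mul_eq_mul_left hp h2
      rw [← hyw, ← quot_quot]
      refine ih y hy (fun z hz => ?_) w hw
      have h1 := hdvd' _ (mem_quot.1 hz)
      rw [deg_mul, hy] at h1
      exact Nat.dvd_of_mul_dvd_mul_left hp h1

theorem Dec.nonempty {T : Set M} (hT : Dec T) : T.Nonempty := by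
  induction hT with
  | root => exact Set.singleton_nonempty _
  | node r T hr hdvd h ih =>
    obtain ⟨z, hz⟩ := ih (ofIdx r 0 hr) (deg_ofIdx _ _ _)
    exact ⟨_, mem_quot.1 hz⟩

theorem eq_iUnion_quot {T : Set M} {r : ℕ} (hdvd : ∀ x ∈ T, r ∣ deg x) :
    T = ⋃ u ∈ level M r, (u * ·) '' quot u T := by
  ext x
  simp only [Set.mem_iUnion, Set.mem_image, exists_prop]
  constructor
  · intro hx
    obtain ⟨u, z, hu, rfl⟩ := exists_factor x r (hdvd x hx)
    exact ⟨u, hu, z, hx, rfl⟩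
  · rintro ⟨u, -, z, hz, rfl⟩
    exact hz

theorem Dec.finite {T : Set M} (hT : Dec T) : T.Finite := by
  induction hT with
  | root => exact Set.finite_singleton _
  | node r T hr hdvd h ih =>
    rw [eq_iUnion_quot hdvd]
    exact (finite_level r).biUnion fun u hu => (ih u hu).image _

/-! ### Sequences of splittings -/

theorem Step.union_mul {A T T' : Set M} {u : M} (hA : ∀ z, u * z ∉ A) (h : Step T T') :
    Step (A ∪ (u * ·) '' T) (A ∪ (u * ·) '' T') := by
  obtain ⟨x, hx, p, hp, rfl⟩ := h
  refine ⟨u * x, Or.inr ⟨x, hx, rfl⟩, p, hp, ?_⟩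
  have hinj : Function.Injective fun z : M => u * z := fun _ _ => mul_cancel
  have hdiff : A \ {u * x} = A := Set.sdiff_singleton_eq_self (hA x)
  rw [split, split, Set.union_sdiff_distrib, hdiff, Set.image_union, Set.image_sdiff hinj,
    Set.image_singleton, Set.union_assoc, Set.image_image]
  simp only [mul_assoc]

theorem refines_union_mul {A T T' : Set M} {u : M} (hA : ∀ z, u * z ∉ A)
    (h : Relation.ReflTransGen Step T T') :
    Relation.ReflTransGen Step (A ∪ (u * ·) '' T) (A ∪ (u * ·) '' T') := by
  induction h with
  | refl => exact .refl
  | tail _ h ih => exact ih.tail (h.union_mul hA)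

/-- Blocks over distinct cells of level `r` are disjoint, so they can be refined one after another;
`U` in the proof is the set of cells already refined. -/
theorem refines_of_quot {T : Set M} {r : ℕ} (hdvd : ∀ x ∈ T, r ∣ deg x)
    (h : ∀ u, deg u = r → Relation.ReflTransGen Step {1} (quot u T)) :
    Relation.ReflTransGen Step (level M r) T := by
  have key : ∀ U ⊆ level M r, U.Finite → Relation.ReflTransGen Step (level M r)
      ((level M r \ U) ∪ ⋃ u ∈ U, (u * ·) '' quot u T) := by
    intro U hU hfin
    induction U, hfin using Set.Finite.induction_on with
    | empty => simp only [Set.sdiff_empty, Set.mem_empty_iff_false, Set.iUnion_false,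
        Set.iUnion_empty, Set.union_empty]; exact .refl
    | @insert v U hv _ ih =>
      have hvr : deg v = r := hU (Set.mem_insert _ _)
      refine (ih fun x hx => hU (Set.mem_insert_of_mem _ hx)).trans ?_
      have hA : ∀ z, v * z ∉
          (level M r \ insert v U) ∪ ⋃ u ∈ U, (u * ·) '' quot u T := by
        rintro z (⟨hz, hz'⟩ | hz)
        · rw [mem_level, deg_mul, hvr] at hz
          have hz1 : deg z = 1 := Nat.eq_of_mul_eq_mul_left (hvr ▸ deg_pos v) (by rw [hz, mul_one])
          rw [eq_one_of_deg hz1, mul_one] at hz'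
          exact hz' (Set.mem_insert _ _)
        · simp only [Set.mem_iUnion, Set.mem_image, exists_prop] at hz
          obtain ⟨u, hu, w, -, hw⟩ := hz
          have hur : deg u = r := hU (Set.mem_insert_of_mem _ hu)
          exact hv ((factor_unique _ _ _ _ (hur.trans hvr.symm) hw).1 ▸ hu)
      have h1 := refines_union_mul hA (h v hvr)
      convert h1 using 1
      · rw [Set.image_singleton, mul_one, Set.union_right_comm]
        congr 1
        ext x
        simp only [Set.mem_union, Set.mem_sdiff, Set.mem_insert_iff, Set.mem_singleton_iff]
        constructor
        · rintro ⟨hx, hx'⟩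
          by_cases hxv : x = v
          · exact Or.inr hxv
          · exact Or.inl ⟨hx, fun h => h.elim hxv hx'⟩
        · rintro (⟨hx, hx'⟩ | rfl)
          · exact ⟨hx, fun h => hx' (Or.inr h)⟩
          · exact ⟨hvr, hv⟩
      · rw [Set.biUnion_insert, Set.union_assoc, Set.union_comm ((v * ·) '' _)]
  have h1 := key _ subset_rfl (finite_level r)
  rwa [Set.sdiff_self, Set.empty_union, ← eq_iUnion_quot hdvd] at h1

theorem Dec.refines_one {T : Set M} (hT : Dec T) : Relation.ReflTransGen Step {1} T := by
  induction hT with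
  | root => exact .refl
  | node r T hr hdvd h ih =>
    refine Relation.ReflTransGen.trans ?_ (refines_of_quot hdvd ih)
    -- A splitting needs at least two parts, so level 1 is reached by the empty sequence and any
    -- other level by one splitting of the root.
    rcases hr.eq_or_lt with rfl | hr
    · rw [level_one]
    · exact .single ⟨1, rfl, r, hr, by simp [CellMonoid.split]⟩

theorem refines_level_iff {T : Set M} {r : ℕ} (hr : 1 ≤ r) :
    Relation.ReflTransGen Step (level M r) T ↔ Dec T ∧ ∀ x ∈ T, r ∣ deg x := by
  constructor
  · intro h
    induction h with
    | refl => exact ⟨dec_level hr, fun x hx => (mem_level.1 hx).symm.dvd⟩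
    | tail _ h ih =>
      obtain ⟨x, hx, p, hp, rfl⟩ := h
      exact ⟨ih.1.split hx (by omega), dvd_deg_split p hx ih.2⟩
  · rintro ⟨hT, hdvd⟩
    exact refines_of_quot hdvd fun u hu => (hT.quot hdvd u hu).refines_one

theorem refines_one_iff {T : Set M} : Relation.ReflTransGen Step {1} T ↔ Dec T := by
  rw [← level_one, refines_level_iff le_rfl]
  exact and_iff_left fun x _ => one_dvd _

/-! ### Greatest common divisors of the degrees -/

/-- `r` is the greatest common divisor of the degrees of the members of `T`. -/
def IsGcd (T : Set M) (r : ℕ) : Prop := ∀ d, (∀ x ∈ T, d ∣ deg x) ↔ d ∣ r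

theorem IsGcd.dvd {T : Set M} {r : ℕ} (h : IsGcd T r) : ∀ x ∈ T, r ∣ deg x :=
  (h r).2 dvd_rfl

theorem IsGcd.unique {T : Set M} {r s : ℕ} (h : IsGcd T r) (h' : IsGcd T s) : r = s :=
  Nat.dvd_antisymm ((h' r).1 h.dvd) ((h s).1 h'.dvd)

theorem isGcd_one : IsGcd ({1} : Set M) 1 := fun d => by simp

theorem Dec.exists_isGcd {T : Set M} (hT : Dec T) : ∃ r, IsGcd T r := by
  refine ⟨hT.finite.toFinset.gcd deg, fun d => ?_⟩
  rw [Finset.dvd_gcd_iff]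
  simp

theorem Dec.isGcd_pos {T : Set M} (hT : Dec T) {r : ℕ} (h : IsGcd T r) : 1 ≤ r := by
  obtain ⟨x, hx⟩ := hT.nonempty
  exact Nat.pos_of_dvd_of_pos (h.dvd x hx) (deg_pos x)

theorem Dec.eq_one_or_dvd {T : Set M} (hT : Dec T) :
    T = {1} ∨ ∃ r, 2 ≤ r ∧ ∀ x ∈ T, r ∣ deg x := by
  induction hT with
  | root => exact Or.inl rfl
  | node r T hr hdvd h ih =>
    -- A cut into one part has `T` itself as its only block, so the induction hypothesis already
    -- decides.
    rcases hr.eq_or_lt with rfl | hr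
    · simpa only [quot_one] using ih 1 deg_one
    · exact Or.inr ⟨r, hr, hdvd⟩

theorem Dec.eq_one_or_isGcd {T : Set M} (hT : Dec T) : T = {1} ∨ ∃ r, 2 ≤ r ∧ IsGcd T r := by
  refine hT.eq_one_or_dvd.imp_right ?_
  rintro ⟨s, hs, hdvd⟩
  obtain ⟨r, hr⟩ := hT.exists_isGcd
  exact ⟨r, hs.trans (Nat.le_of_dvd (hT.isGcd_pos hr) ((hr s).1 hdvd)), hr⟩

/-- Every decomposition has an indexed partition into its `r` blocks. -/
theorem exists_equiv_sigma {T : Set M} {r : ℕ} (hdvd : ∀ x ∈ T, r ∣ deg x) :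
    Nonempty ((Σ j : Fin r, quot (ofIdx r j j.2) T) ≃ T) := by
  refine ⟨Equiv.ofBijective (fun p => ⟨ofIdx r p.1 p.1.2 * p.2.1, p.2.2⟩) ⟨?_, ?_⟩⟩
  · rintro ⟨i, z, hz⟩ ⟨j, w, hw⟩ h
    obtain ⟨h1, h2⟩ := factor_unique _ _ _ _ (by rw [deg_ofIdx, deg_ofIdx])
      (congrArg Subtype.val h)
    have h3 := congrArg idx h1
    rw [idx_ofIdx, idx_ofIdx] at h3
    obtain rfl := Fin.ext h3
    obtain rfl : z = w := h2
    rfl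
  · rintro ⟨x, hx⟩
    obtain ⟨u, z, hu, rfl⟩ := exists_factor x r (hdvd x hx)
    have h1 : ofIdx r (idx u) (hu ▸ idx_lt u) = u := ofIdx_eq hu rfl _
    exact ⟨⟨⟨idx u, hu ▸ idx_lt u⟩, ⟨z, by rw [mem_quot, h1]; exact hx⟩⟩,
      Subtype.ext (congrArg (· * z) h1)⟩

theorem Dec.two_le_ncard {T : Set M} (hT : Dec T) {r : ℕ} (hr : 2 ≤ r)
    (hdvd : ∀ x ∈ T, r ∣ deg x) : 2 ≤ T.ncard := by
  have h : ∀ j (hj : j < r), ∃ z, ofIdx r j hj * z ∈ T := fun j hj =>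
    (hT.quot hdvd _ (deg_ofIdx _ _ _)).nonempty
  obtain ⟨z, hz⟩ := h 0 (by omega)
  obtain ⟨w, hw⟩ := h 1 (by omega)
  refine (Set.one_lt_ncard hT.finite).2 ⟨_, hz, _, hw, fun e => ?_⟩
  have h1 := congrArg idx (factor_unique _ _ _ _ (by rw [deg_ofIdx, deg_ofIdx]) e).1
  rw [idx_ofIdx, idx_ofIdx] at h1
  omega

/-! ### The correspondence between decompositions over two cell monoids -/

/-- Decompositions over two cell monoids that have the same gcd and corresponding blocks. -/
inductive Corr : Set M → Set N → Prop
  | root : Corr {1} {1}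
  | node (r : ℕ) (T : Set M) (T' : Set N) (hr : 2 ≤ r) (hT : IsGcd T r) (hT' : IsGcd T' r)
      (h : ∀ j (hj : j < r), Corr (quot (ofIdx r j hj) T) (quot (ofIdx r j hj) T')) : Corr T T'

theorem Corr.symm {T : Set M} {T' : Set N} (h : Corr T T') : Corr T' T := by
  induction h with
  | root => exact .root
  | node r T T' hr hT hT' _ ih => exact .node r T' T hr hT' hT ih

theorem Corr.dec {T : Set M} {T' : Set N} (h : Corr T T') : Dec T := by
  induction h with
  | root => exact .root
  | node r T T' hr hT _ _ ih =>
    refine .node r T (by omega) hT.dvd fun u hu => ?_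
    rw [← ofIdx_eq hu rfl (hu ▸ idx_lt u)]
    exact ih _ _

theorem Corr.isGcd_iff {T : Set M} {T' : Set N} (h : Corr T T') (r : ℕ) :
    IsGcd T r ↔ IsGcd T' r := by
  cases h with
  | root => exact ⟨fun h => h.unique isGcd_one ▸ isGcd_one, fun h => h.unique isGcd_one ▸ isGcd_one⟩
  | node s _ _ _ hT hT' => exact ⟨fun h => h.unique hT ▸ hT', fun h => h.unique hT' ▸ hT⟩

theorem Corr.ncard_eq {T : Set M} {T' : Set N} (h : Corr T T') : T.ncard = T'.ncard := by
  suffices Nonempty (T ≃ T') from Nat.card_congr this.some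
  induction h with
  | root => exact ⟨Equiv.ofUnique _ _⟩
  | node r T T' hr hT hT' _ ih =>
    exact ⟨(exists_equiv_sigma hT.dvd).some.symm.trans
      ((Equiv.sigmaCongrRight fun j : Fin r => (ih j j.2).some).trans
        (exists_equiv_sigma hT'.dvd).some)⟩

/-- The gcd is determined by `T`, so both correspondences use the same cut; their blocks agree by
induction, and a set is the union of its blocks. -/
theorem Corr.right_unique {T : Set M} {T₁ : Set N} (h₁ : Corr T T₁) :
    ∀ {T₂ : Set N}, Corr T T₂ → T₁ = T₂ := by
  induction h₁ with
  | root =>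
    intro T₂ h
    generalize hT : ({1} : Set M) = T at h
    cases h with
    | root => rfl
    | node r _ _ hr hT₁ =>
      subst hT
      have := hT₁.unique isGcd_one
      omega
  | node r T T₁ hr hT hT₁ _ ih =>
    intro T₂ h
    cases h with
    | root =>
      have := hT.unique isGcd_one
      omega
    | node s _ _ hs hT' hT₂ h =>
      obtain rfl := hT.unique hT'
      rw [eq_iUnion_quot hT₁.dvd, eq_iUnion_quot hT₂.dvd]
      refine Set.iUnion₂_congr fun v hv => ?_
      rw [← ofIdx_eq hv rfl (mem_level.1 hv ▸ idx_lt v), ih _ _ (h _ _)]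

theorem dvd_mul_iff_div_gcd_dvd {d r m : ℕ} (hr : 0 < r) : d ∣ r * m ↔ d / Nat.gcd d r ∣ m := by
  have hg : 0 < Nat.gcd d r := Nat.gcd_pos_of_pos_right _ hr
  rw [← (Nat.coprime_div_gcd_div_gcd hg).dvd_mul_left,
    ← Nat.mul_dvd_mul_iff_left hg (b := d / Nat.gcd d r), ← mul_assoc,
    Nat.mul_div_cancel' (Nat.gcd_dvd_left d r), Nat.mul_div_cancel' (Nat.gcd_dvd_right d r)]

/-- Since a degree in `T` is `r` times a degree in a block, divisibility by `d` becomes divisibility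
by d/gcd(d, r) in each block. This lets a gcd be compared blockwise. -/
theorem forall_dvd_iff_quot {T : Set M} {r : ℕ} (hr : 0 < r) (hdvd : ∀ x ∈ T, r ∣ deg x) (d : ℕ) :
    (∀ x ∈ T, d ∣ deg x) ↔
      ∀ j (hj : j < r), ∀ z ∈ quot (ofIdx r j hj) T, d / Nat.gcd d r ∣ deg z := by
  constructor
  · intro h j hj z hz
    have h1 := h _ (mem_quot.1 hz)
    rwa [deg_mul, deg_ofIdx, dvd_mul_iff_div_gcd_dvd hr] at h1
  · intro h x hx
    obtain ⟨u, z, hu, rfl⟩ := exists_factor x r (hdvd x hx)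
    rw [deg_mul, hu, dvd_mul_iff_div_gcd_dvd hr]
    refine h (idx u) (hu ▸ idx_lt u) z ?_
    rw [ofIdx_eq hu rfl]
    exact hx

theorem Corr.forall_dvd_iff {T : Set M} {T' : Set N} (h : Corr T T') (d : ℕ) :
    (∀ x ∈ T, d ∣ deg x) ↔ ∀ x ∈ T', d ∣ deg x := by
  cases h with
  | root => rw [isGcd_one d, isGcd_one d]
  | node r _ _ _ hT hT' => rw [hT d, hT' d]

/-- Induction on a degree bound: blocks over the gcd `r ≥ 2` have degrees at most `B / r < B`. Their
partners are glued along the cells of degree `r` of the other monoid. -/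
theorem exists_corr_of_le (B : ℕ) : ∀ {T : Set M}, Dec T → (∀ x ∈ T, deg x ≤ B) →
    ∃ T' : Set N, Corr T T' := by
  induction B using Nat.strong_induction_on with
  | _ B ih =>
    intro T hT hB
    rcases hT.eq_one_or_isGcd with rfl | ⟨r, hr, hg⟩
    · exact ⟨_, .root⟩
    have hB0 : 0 < B := by
      obtain ⟨x, hx⟩ := hT.nonempty
      exact (deg_pos x).trans_le (hB x hx)
    have hex : ∀ j : Fin r, ∃ T' : Set N, Corr (quot (ofIdx r j j.2) T) T' := fun j => by
      refine ih (B / r) (Nat.div_lt_self hB0 hr) (hT.quot hg.dvd _ (deg_ofIdx _ _ _)) ?_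
      intro z hz
      have h1 := hB _ (mem_quot.1 hz)
      rw [deg_mul, deg_ofIdx] at h1
      rw [Nat.le_div_iff_mul_le (by omega), mul_comm]
      exact h1
    choose F hF using hex
    let T' : Set N := ⋃ j : Fin r, (ofIdx r j j.2 * ·) '' F j
    have hquot : ∀ j (hj : j < r), quot (ofIdx r j hj) T' = F ⟨j, hj⟩ := by
      intro j hj
      ext z
      simp only [T', mem_quot, Set.mem_iUnion, Set.mem_image]
      constructor
      · rintro ⟨i, w, hw, h⟩
        obtain ⟨h1, rfl⟩ := factor_unique _ _ _ _ (by rw [deg_ofIdx, deg_ofIdx]) h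
        have h2 := congrArg idx h1
        rw [idx_ofIdx, idx_ofIdx] at h2
        obtain rfl : i = ⟨j, hj⟩ := Fin.ext h2
        exact hw
      · exact fun hz => ⟨⟨j, hj⟩, z, hz, rfl⟩
    refine ⟨T', .node r T T' hr hg (fun d => ?_) fun j hj => by
      rw [hquot]
      exact hF ⟨j, hj⟩⟩
    have hdvd' : ∀ x ∈ T', r ∣ deg x := by
      intro x hx
      simp only [T', Set.mem_iUnion, Set.mem_image] at hx
      obtain ⟨j, w, -, rfl⟩ := hx
      rw [deg_mul, deg_ofIdx]
      exact dvd_mul_right _ _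
    -- Matched blocks have the same common divisors, so the glued set has gcd exactly `r`, not a
    -- proper multiple.
    rw [← hg d, forall_dvd_iff_quot (by omega) hdvd', forall_dvd_iff_quot (by omega) hg.dvd]
    refine forall₂_congr fun j hj => ?_
    rw [hquot]
    exact ((hF ⟨j, hj⟩).forall_dvd_iff _).symm

theorem Dec.exists_corr {T : Set M} (hT : Dec T) : ∃ T' : Set N, Corr T T' := by
  obtain ⟨B, hB⟩ := (hT.finite.image deg).bddAbove
  exact exists_corr_of_le B hT fun x hx => hB ⟨x, hx, rfl⟩

end CellMonoid

/-! ### Transport of splitting sequences to sets of intervals or classes -/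

open CellMonoid

theorem reflTransGen_apply_iff {β γ : Type*} {f : β → γ} {R : β → β → Prop} {Q : γ → γ → Prop}
    (h : ∀ b c, Q (f b) c ↔ ∃ b', R b b' ∧ c = f b') {b : β} {c : γ} :
    Relation.ReflTransGen Q (f b) c ↔ ∃ b', Relation.ReflTransGen R b b' ∧ c = f b' := by
  constructor
  · intro hc
    induction hc with
    | refl => exact ⟨b, .refl, rfl⟩
    | tail _ hs ih =>
      obtain ⟨b', hb', rfl⟩ := ih
      obtain ⟨b'', hb'', rfl⟩ := (h _ _).1 hs
      exact ⟨b'', hb'.tail hb'', rfl⟩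
  · rintro ⟨b', hb', rfl⟩
    induction hb' with
    | refl => exact .refl
    | tail _ hs ih => exact ih.tail ((h _ _).2 ⟨_, hs, rfl⟩)

theorem image_split {M α : Type*} [CellMonoid M] {f : M → α} (hf : Function.Injective f)
    (T : Set M) (x : M) (p : ℕ) :
    f '' split T x p = (f '' T \ {f x}) ∪ f '' ((x * ·) '' level M p) := by
  rw [split, Set.image_union, Set.image_sdiff hf, Set.image_singleton]

/-! ### Intervals as cells -/

/-- The cell that stands for the interval `(idx / deg, (idx + 1) / deg)`. -/
@[ext] structure IntervalCell where
  deg : ℕ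
  idx : ℕ
  idx_lt : idx < deg

namespace IntervalCell

/-- In `x * y` the cell `y` sits inside `x`, so `x` supplies the leading digit of the index. -/
instance : Mul IntervalCell where
  mul x y := ⟨x.deg * y.deg, x.idx * y.deg + y.idx, by
    have h1 := x.idx_lt
    have h2 := y.idx_lt
    have h3 : (x.idx + 1) * y.deg ≤ x.deg * y.deg := Nat.mul_le_mul_right _ h1
    rw [add_mul] at h3
    omega⟩

instance : One IntervalCell where
  one := ⟨1, 0, one_pos⟩

theorem deg_mul (x y : IntervalCell) : (x * y).deg = x.deg * y.deg := rfl

theorem idx_mul (x y : IntervalCell) : (x * y).idx = x.idx * y.deg + y.idx := rfl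

theorem deg_one : (1 : IntervalCell).deg = 1 := rfl

theorem idx_one : (1 : IntervalCell).idx = 0 := rfl

instance : CellMonoid IntervalCell where
  mul_assoc x y z := by
    ext
    · simp only [deg_mul, mul_assoc]
    · simp only [deg_mul, idx_mul]; ring
  one_mul x := by ext <;> simp [deg_mul, idx_mul, deg_one, idx_one]
  mul_one x := by ext <;> simp [deg_mul, idx_mul, deg_one, idx_one]
  deg := deg
  idx := idx
  ofIdx m a h := ⟨m, a, h⟩
  idx_lt := idx_lt
  deg_ofIdx _ _ _ := rfl
  idx_ofIdx _ _ _ := rfl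
  ext_deg_idx _ _ := IntervalCell.ext
  deg_mul := deg_mul
  exists_factor := by
    rintro ⟨m, a, h⟩ r ⟨s, rfl : m = r * s⟩
    have hs : 0 < s := Nat.pos_of_ne_zero (by rintro rfl; simp at h)
    refine ⟨⟨r, a / s, Nat.div_lt_of_lt_mul (by rwa [mul_comm])⟩, ⟨s, a % s, Nat.mod_lt _ hs⟩,
      rfl, IntervalCell.ext rfl ?_⟩
    exact Nat.div_add_mod' a s
  factor_unique := by
    rintro ⟨m, a, ha⟩ ⟨k, b, hb⟩ ⟨m', a', ha'⟩ ⟨k', b', hb'⟩ (rfl : m = m') h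
    have h1 : m * k = m * k' := congrArg deg h
    have h2 : a * k + b = a' * k' + b' := congrArg idx h
    obtain rfl := Nat.eq_of_mul_eq_mul_left (by omega) h1
    have h3 : a = a' := by
      have := congrArg (· / k) h2
      simpa [mul_comm _ k, Nat.mul_add_div (show 0 < k by omega),
        Nat.div_eq_of_lt hb, Nat.div_eq_of_lt hb'] using this
    subst h3
    obtain rfl : b = b' := by omega
    exact ⟨rfl, rfl⟩

/-- The open interval described by a cell. -/
def toSet (x : IntervalCell) : Set ℝ :=
  Set.Ioo ((x.idx : ℝ) / x.deg) (((x.idx : ℝ) + 1) / x.deg)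

theorem cast_deg_pos (x : IntervalCell) : (0 : ℝ) < x.deg := by
  exact_mod_cast (Nat.zero_le _).trans_lt x.idx_lt

theorem left_lt_right (x : IntervalCell) :
    (x.idx : ℝ) / x.deg < ((x.idx : ℝ) + 1) / x.deg := by
  have := x.cast_deg_pos
  gcongr
  linarith

theorem Ioo_eq_Ioo {a b c d : ℝ} (hab : a < b) (hcd : c < d) (h : Set.Ioo a b = Set.Ioo c d) :
    a = c ∧ b = d :=
  ⟨by rw [← csInf_Ioo hab, h, csInf_Ioo hcd], by rw [← csSup_Ioo hab, h, csSup_Ioo hcd]⟩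

theorem toSet_injective : Function.Injective toSet := by
  intro x y h
  obtain ⟨h1, h2⟩ := Ioo_eq_Ioo x.left_lt_right y.left_lt_right h
  -- With equal left endpoints, the right endpoints compare the lengths `1 / deg`.
  rw [add_div, add_div, h1, add_right_inj, one_div, one_div, inv_inj] at h2
  have hd : x.deg = y.deg := by exact_mod_cast h2
  rw [h2, div_left_inj' y.cast_deg_pos.ne'] at h1
  exact IntervalCell.ext hd (by exact_mod_cast h1)

theorem equalParts_toSet (x : IntervalCell) {p : ℕ} :
    equalParts ((x.idx : ℝ) / x.deg) (((x.idx : ℝ) + 1) / x.deg) p =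
      toSet '' ((x * ·) '' level IntervalCell p) := by
  have hx := x.cast_deg_pos.ne'
  have key : ∀ y : IntervalCell, toSet (x * y) =
      Set.Ioo ((x.idx : ℝ) / x.deg + (y.idx : ℝ) / y.deg * (((x.idx : ℝ) + 1) / x.deg -
          (x.idx : ℝ) / x.deg))
        ((x.idx : ℝ) / x.deg + ((y.idx : ℝ) + 1) / y.deg * (((x.idx : ℝ) + 1) / x.deg -
          (x.idx : ℝ) / x.deg)) := by
    intro y
    have hy := y.cast_deg_pos.ne'
    rw [toSet, deg_mul, idx_mul]
    push_cast
    congr 1 <;> field_simp <;> ring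
  rw [Set.image_image]
  ext R
  constructor
  · rintro ⟨j, hj, rfl⟩
    exact ⟨⟨p, j, hj⟩, rfl, key _⟩
  · rintro ⟨y, rfl, rfl⟩
    exact ⟨y.idx, y.idx_lt, key y⟩

theorem splitStep_iff (T : Set IntervalCell) (S : Set (Set ℝ)) :
    SplitStep (toSet '' T) S ↔ ∃ T', Step T T' ∧ S = toSet '' T' := by
  constructor
  · rintro ⟨a, b, p, hab, hp, ⟨x, hx, hxab⟩, rfl⟩
    obtain ⟨rfl, rfl⟩ := Ioo_eq_Ioo x.left_lt_right hab hxab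
    refine ⟨_, ⟨x, hx, p, hp, rfl⟩, ?_⟩
    rw [image_split toSet_injective, equalParts_toSet]
    rfl
  · rintro ⟨_, ⟨x, hx, p, hp, rfl⟩, rfl⟩
    refine ⟨_, _, p, x.left_lt_right, hp, ⟨x, hx, rfl⟩, ?_⟩
    rw [image_split toSet_injective, equalParts_toSet]
    rfl

theorem toSet_one : toSet 1 = Set.Ioo 0 1 := by
  simp [toSet, deg_one, idx_one]

theorem equalDecomposition_eq (r : ℕ) :
    equalDecomposition r = toSet '' level IntervalCell r := by
  have h := equalParts_toSet 1 (p := r)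
  simpa [deg_one, idx_one, equalDecomposition] using h

theorem refines_equalDecomposition_iff {S : Set (Set ℝ)} {r : ℕ} (hr : 1 ≤ r) :
    Refines S (equalDecomposition r) ↔
      ∃ T : Set IntervalCell, (Dec T ∧ ∀ x ∈ T, r ∣ x.deg) ∧ S = toSet '' T := by
  rw [Refines, equalDecomposition_eq, reflTransGen_apply_iff splitStep_iff]
  simp only [refines_level_iff hr]
  rfl

theorem isDecomposition_iff {S : Set (Set ℝ)} :
    IsDecomposition S ↔ ∃ T : Set IntervalCell, Dec T ∧ S = toSet '' T := by
  rw [IsDecomposition, Refines, ← toSet_one, ← Set.image_singleton,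
    reflTransGen_apply_iff splitStep_iff]
  simp only [refines_one_iff]

/-- Refining `D_s` means that `s` divides all degrees, hence divides `r`; so the greatest common
divisor is also the largest admissible number. -/
theorem isDecompositionGcd {T : Set IntervalCell} {r : ℕ} (hT : Dec T) (h : IsGcd T r) :
    IsDecompositionGcd (toSet '' T) r := by
  have hr := hT.isGcd_pos h
  refine ⟨hr, (refines_equalDecomposition_iff hr).2 ⟨T, ⟨hT, h.dvd⟩, rfl⟩, fun s hs hS => ?_⟩
  obtain ⟨T', ⟨-, hdvd⟩, hT'⟩ := (refines_equalDecomposition_iff (by omega)).1 hS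
  obtain rfl := toSet_injective.image_injective hT'
  exact absurd (Nat.le_of_dvd hr ((h s).1 hdvd)) (by omega)

theorem toSet_mul (u z : IntervalCell) : toSet (u * z) =
    (fun t : ℝ => (t + u.idx) / u.deg) '' toSet z := by
  have hu := u.cast_deg_pos
  have hz := z.cast_deg_pos
  have h1 : ((u.idx * z.deg + z.idx : ℕ) : ℝ) / ((u.deg * z.deg : ℕ) : ℝ) =
      ((z.idx : ℝ) / z.deg + u.idx) / u.deg := by
    push_cast; field_simp; ring
  have h2 : (((u.idx * z.deg + z.idx : ℕ) : ℝ) + 1) / ((u.deg * z.deg : ℕ) : ℝ) =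
      (((z.idx : ℝ) + 1) / z.deg + u.idx) / u.deg := by
    push_cast; field_simp; ring
  ext t
  rw [toSet, deg_mul, idx_mul, h1, h2, toSet, Set.mem_Ioo, div_lt_iff₀ hu, lt_div_iff₀ hu]
  simp only [Set.mem_image, Set.mem_Ioo]
  constructor
  · rintro ⟨h3, h4⟩
    exact ⟨t * u.deg - u.idx, ⟨by linarith, by linarith⟩, by field_simp; ring⟩
  · rintro ⟨s, ⟨h3, h4⟩, rfl⟩
    rw [div_mul_cancel₀ _ hu.ne']
    exact ⟨by linarith, by linarith⟩

theorem scale_toSet_mul (u z : IntervalCell) :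
    scale ((u.idx : ℝ) / u.deg) (((u.idx : ℝ) + 1) / u.deg) 0 1 (toSet (u * z)) = toSet z := by
  have hu := u.cast_deg_pos.ne'
  have h : ∀ t : ℝ, (0 : ℝ) + (1 - 0) / (((u.idx : ℝ) + 1) / u.deg - (u.idx : ℝ) / u.deg) *
      ((t + u.idx) / u.deg - (u.idx : ℝ) / u.deg) = t := by
    intro t
    rw [← sub_div, ← sub_div]
    field_simp
    ring
  rw [scale, toSet_mul, Set.image_image]
  simp only [h, Set.image_id']

theorem toSet_subset_unit (z : IntervalCell) : toSet z ⊆ Set.Ioo 0 1 := by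
  have hz := z.cast_deg_pos
  refine Set.Ioo_subset_Ioo (by positivity) ?_
  rw [div_le_one hz]
  exact_mod_cast z.idx_lt

theorem toSet_mul_subset (u z : IntervalCell) : toSet (u * z) ⊆ toSet u := by
  rw [toSet_mul]
  conv_rhs => rw [← mul_one u, toSet_mul, toSet_one]
  exact Set.image_mono z.toSet_subset_unit

/-- Two intervals of the same level that share a point coincide: their integer indices differ by
less than 1. -/
theorem eq_of_toSet_mul_subset {u v z : IntervalCell} (hd : v.deg = u.deg)
    (h : toSet (v * z) ⊆ toSet u) : v = u := by
  obtain ⟨t, ht⟩ := Set.nonempty_Ioo.2 (v * z).left_lt_right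
  obtain ⟨h1, h2⟩ := h ht
  obtain ⟨h3, h4⟩ := toSet_mul_subset v z ht
  have hu := u.cast_deg_pos
  rw [hd] at h3 h4
  rw [div_lt_iff₀ hu] at h1 h3
  rw [lt_div_iff₀ hu] at h2 h4
  have h5 : (u.idx : ℝ) < v.idx + 1 := by linarith
  have h6 : (v.idx : ℝ) < u.idx + 1 := by linarith
  norm_cast at h5 h6
  exact IntervalCell.ext hd (by omega)

theorem piece_image {T : Set IntervalCell} (u : IntervalCell) (hdvd : ∀ x ∈ T, u.deg ∣ x.deg) :
    piece (toSet '' T) u.deg u.idx = toSet '' quot u T := by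
  ext R
  constructor
  · rintro ⟨_, ⟨⟨x, hx, rfl⟩, hsub⟩, rfl⟩
    obtain ⟨v, z, hv, rfl⟩ := exists_factor x u.deg (hdvd x hx)
    obtain rfl := eq_of_toSet_mul_subset hv hsub
    exact ⟨z, hx, (scale_toSet_mul v z).symm⟩
  · rintro ⟨z, hz, rfl⟩
    exact ⟨_, ⟨⟨_, hz, rfl⟩, toSet_mul_subset u z⟩, scale_toSet_mul u z⟩

end IntervalCell

/-! ### Residue classes as cells -/

/-- The cell that stands for the residue class of `idx` modulo `deg`. -/
@[ext] structure ResidueCell where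
  deg : ℕ
  idx : ℕ
  idx_lt : idx < deg

namespace ResidueCell

/-- Here the outer cell `x` supplies the lowest digit, as in `t ↦ deg * t + idx`. This is the only
difference from intervals. -/
instance : Mul ResidueCell where
  mul x y := ⟨x.deg * y.deg, x.deg * y.idx + x.idx, by
    have h1 := x.idx_lt
    have h2 := y.idx_lt
    have h3 : x.deg * (y.idx + 1) ≤ x.deg * y.deg := Nat.mul_le_mul_left _ h2
    rw [mul_add] at h3
    omega⟩

instance : One ResidueCell where
  one := ⟨1, 0, one_pos⟩

theorem deg_mul (x y : ResidueCell) : (x * y).deg = x.deg * y.deg := rfl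

theorem idx_mul (x y : ResidueCell) : (x * y).idx = x.deg * y.idx + x.idx := rfl

theorem deg_one : (1 : ResidueCell).deg = 1 := rfl

theorem idx_one : (1 : ResidueCell).idx = 0 := rfl

theorem deg_pos (x : ResidueCell) : 0 < x.deg := (Nat.zero_le _).trans_lt x.idx_lt

instance : CellMonoid ResidueCell where
  mul_assoc x y z := by
    ext
    · simp only [deg_mul, mul_assoc]
    · simp only [deg_mul, idx_mul]; ring
  one_mul x := by ext <;> simp [deg_mul, idx_mul, deg_one, idx_one]
  mul_one x := by ext <;> simp [deg_mul, idx_mul, deg_one, idx_one]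
  deg := deg
  idx := idx
  ofIdx m a h := ⟨m, a, h⟩
  idx_lt := idx_lt
  deg_ofIdx _ _ _ := rfl
  idx_ofIdx _ _ _ := rfl
  ext_deg_idx _ _ := ResidueCell.ext
  deg_mul := deg_mul
  exists_factor := by
    rintro ⟨m, a, h⟩ r ⟨s, rfl : m = r * s⟩
    have hr : 0 < r := Nat.pos_of_ne_zero (by rintro rfl; simp at h)
    refine ⟨⟨r, a % r, Nat.mod_lt _ hr⟩, ⟨s, a / r, Nat.div_lt_of_lt_mul h⟩,
      rfl, ResidueCell.ext rfl ?_⟩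
    exact Nat.div_add_mod a r
  factor_unique := by
    rintro ⟨m, a, ha⟩ ⟨k, b, hb⟩ ⟨m', a', ha'⟩ ⟨k', b', hb'⟩ (rfl : m = m') h
    have h1 : m * k = m * k' := congrArg deg h
    have h2 : m * b + a = m * b' + a' := congrArg idx h
    have hm : 0 < m := by omega
    obtain rfl := Nat.eq_of_mul_eq_mul_left hm h1
    have h3 : b = b' := by
      have := congrArg (· / m) h2
      simpa [Nat.mul_add_div hm, Nat.div_eq_of_lt ha, Nat.div_eq_of_lt ha'] using this
    subst h3
    obtain rfl : a = a' := by omega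
    exact ⟨rfl, rfl⟩

/-- The residue class described by a cell. -/
def toSet (x : ResidueCell) : Set ℤ := resClass x.idx x.deg

theorem mem_resClass {x a : ℤ} {n : ℕ} : x ∈ resClass a n ↔ x ≡ a [ZMOD (n : ℤ)] := Iff.rfl

theorem resClass_eq_iff {a b : ℤ} {m n : ℕ} :
    resClass a m = resClass b n ↔ m = n ∧ a ≡ b [ZMOD (n : ℤ)] := by
  constructor
  · intro h
    -- Both `a` and `a + m` lie in the class modulo `n`, so `n` divides their difference.
    have key : ∀ {a b : ℤ} {m n : ℕ}, resClass a m = resClass b n → n ∣ m := by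
      intro a b m n h
      have h1 : a ∈ resClass b n := h ▸ mem_resClass.2 rfl
      have h2 : a + m ∈ resClass b n := h ▸ mem_resClass.2 (by simp)
      have h3 := (mem_resClass.1 h1).trans (mem_resClass.1 h2).symm
      have h4 := h3.dvd
      rw [add_sub_cancel_left] at h4
      exact_mod_cast h4
    refine ⟨Nat.dvd_antisymm (key h.symm) (key h), ?_⟩
    exact mem_resClass.1 (h ▸ mem_resClass.2 rfl)
  · rintro ⟨rfl, h⟩
    ext x
    exact ⟨fun hx => hx.trans h, fun hx => hx.trans h.symm⟩

theorem toSet_injective : Function.Injective toSet := by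
  intro x y h
  obtain ⟨h1, h2⟩ := resClass_eq_iff.1 h
  refine ResidueCell.ext h1 ?_
  have h3 := Int.natCast_modEq_iff.1 h2
  exact h3.eq_of_lt_of_lt (h1 ▸ x.idx_lt) y.idx_lt

/-- The representative `a` need not be reduced. If `a = x.idx + x.deg * k`, the `i`-th new class has
inner index `i + k` modulo `r`, so the family is only shifted cyclically. -/
theorem splitClass_eq (x : ResidueCell) {a : ℤ} {r : ℕ} (hr : 1 ≤ r)
    (ha : a ≡ x.idx [ZMOD (x.deg : ℤ)]) :
    {T | ∃ i : ℕ, i < r ∧ T = resClass ((i : ℤ) * x.deg + a) (r * x.deg)} =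
      toSet '' ((x * ·) '' level ResidueCell r) := by
  obtain ⟨k, hk⟩ := ha.symm.dvd
  have hr0 : (0 : ℤ) < r := by exact_mod_cast hr
  have key : ∀ (y : ResidueCell) (i : ℕ), y.deg = r → (y.idx : ℤ) ≡ i + k [ZMOD r] →
      toSet (x * y) = resClass ((i : ℤ) * x.deg + a) (r * x.deg) := by
    rintro y i rfl h
    refine resClass_eq_iff.2 ⟨mul_comm _ _, ?_⟩
    rw [idx_mul, show a = x.idx + x.deg * k by linarith]
    push_cast
    rw [mul_comm (y.deg : ℤ)]
    have h1 := (h.mul_left' (c := (x.deg : ℤ))).add_right (x.idx : ℤ)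
    convert h1 using 1
    ring
  rw [Set.image_image]
  ext R
  constructor
  · rintro ⟨i, hi, rfl⟩
    have hnn := Int.emod_nonneg ((i : ℤ) + k) hr0.ne'
    have hlt := Int.emod_lt_of_pos ((i : ℤ) + k) hr0
    refine ⟨⟨r, (((i : ℤ) + k) % r).toNat, by omega⟩, rfl, key _ i rfl ?_⟩
    change ((((i : ℤ) + k) % r).toNat : ℤ) ≡ _ [ZMOD r]
    rw [Int.toNat_of_nonneg hnn]
    exact Int.mod_modEq _ _
  · rintro ⟨y, hy, rfl⟩
    have hnn := Int.emod_nonneg ((y.idx : ℤ) - k) hr0.ne'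
    have hlt := Int.emod_lt_of_pos ((y.idx : ℤ) - k) hr0
    refine ⟨(((y.idx : ℤ) - k) % r).toNat, by omega, key y _ hy ?_⟩
    rw [Int.toNat_of_nonneg hnn]
    have h1 := (Int.mod_modEq ((y.idx : ℤ) - k) r).add_right k
    rw [sub_add_cancel] at h1
    exact h1.symm

theorem necsStep_iff (T : Set ResidueCell) (C : Set (Set ℤ)) :
    NECSStep (toSet '' T) C ↔ ∃ T', Step T T' ∧ C = toSet '' T' := by
  constructor
  · rintro ⟨a, n, r, hn, hr, ⟨x, hx, hxa⟩, rfl⟩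
    obtain ⟨rfl, ha⟩ := resClass_eq_iff.1 hxa
    refine ⟨_, ⟨x, hx, r, hr, rfl⟩, ?_⟩
    rw [image_split toSet_injective, splitClass_eq x (by omega) ha.symm, hxa]
  · rintro ⟨_, ⟨x, hx, r, hr, rfl⟩, rfl⟩
    refine ⟨x.idx, x.deg, r, x.deg_pos, hr, ⟨x, hx, rfl⟩, ?_⟩
    rw [image_split toSet_injective, splitClass_eq x (by omega) rfl]
    rfl

theorem toSet_one : toSet 1 = resClass 0 1 := rfl

theorem isNECS_iff {C : Set (Set ℤ)} :
    IsNECS C ↔ ∃ T : Set ResidueCell, Dec T ∧ C = toSet '' T := by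
  rw [IsNECS, ← toSet_one, ← Set.image_singleton, reflTransGen_apply_iff necsStep_iff]
  simp only [refines_one_iff]

theorem isNECSGcd {T : Set ResidueCell} {r : ℕ} (h : IsGcd T r) : IsNECSGcd (toSet '' T) r := by
  refine ⟨?_, fun d hd => (h d).1 fun x hx => hd x.idx x.deg x.deg_pos ⟨x, hx, rfl⟩⟩
  rintro a n - ⟨x, hx, hxa⟩
  exact (resClass_eq_iff.1 hxa).1 ▸ h.dvd x hx

theorem embedClass_toSet (u z : ResidueCell) :
    embedClass u.idx u.deg (toSet z) = toSet (u * z) := by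
  rw [toSet, embedClass_resClass _ _ u.deg_pos, toSet, deg_mul, idx_mul]
  push_cast
  rfl

end ResidueCell

/-! ### The bijection -/

theorem Phi_image_of_corr {T : Set IntervalCell} {T' : Set ResidueCell} (h : Corr T T') :
    Phi (IntervalCell.toSet '' T) = ResidueCell.toSet '' T' := by
  induction h with
  | root =>
    rw [Set.image_singleton, Set.image_singleton, IntervalCell.toSet_one, ResidueCell.toSet_one,
      Phi_trivial]
  | node r T T' hr hT hT' h ih =>
    have hdec : Dec T := (Corr.node r T T' hr hT hT' h).dec
    have hcard : 2 ≤ (IntervalCell.toSet '' T).ncard := by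
      rw [Set.ncard_image_of_injective _ IntervalCell.toSet_injective]
      exact hdec.two_le_ncard hr hT.dvd
    rw [Phi_eq hcard (IntervalCell.isDecompositionGcd hdec hT)]
    have hpiece : ∀ j : Fin r, embedClass j r '' Phi (piece (IntervalCell.toSet '' T) r j) =
        ResidueCell.toSet '' ((ofIdx r j j.2 * ·) '' quot (ofIdx r j j.2) T') := by
      intro j
      have h1 : piece (IntervalCell.toSet '' T) r j =
          IntervalCell.toSet '' quot (ofIdx r j j.2) T :=
        IntervalCell.piece_image (ofIdx r j j.2) hT.dvd
      rw [h1, ih j j.2, Set.image_image,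
        Set.image_image]
      exact Set.image_congr fun z _ => ResidueCell.embedClass_toSet (ofIdx r j j.2) z
    simp only [hpiece]
    rw [← Set.image_iUnion]
    congr 1
    conv_rhs => rw [eq_iUnion_quot hT'.dvd]
    ext x
    simp only [Set.mem_iUnion, exists_prop]
    constructor
    · rintro ⟨j, hx⟩
      exact ⟨_, deg_ofIdx _ _ _, hx⟩
    · rintro ⟨u, hu, hx⟩
      refine ⟨⟨idx u, mem_level.1 hu ▸ idx_lt u⟩, ?_⟩
      rw [ofIdx_eq hu rfl]
      exact hx

end IntervalNECS

open IntervalNECS CellMonoid in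
theorem proposition5p2 (n : ℕ) (hn : 1 ≤ n) :
    Set.BijOn IntervalNECS.Phi (IntervalNECS.decompositions n) (IntervalNECS.necs n) ∧
      ∀ S ∈ IntervalNECS.decompositions n, ∃ r : ℕ,
        IntervalNECS.IsDecompositionGcd S r ∧ IntervalNECS.IsNECSGcd (IntervalNECS.Phi S) r := by
  have hmem : ∀ {T : Set IntervalCell} {T' : Set ResidueCell}, Corr T T' →
      (IntervalCell.toSet '' T).ncard = (ResidueCell.toSet '' T').ncard := fun h => by
    rw [Set.ncard_image_of_injective _ IntervalCell.toSet_injective,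
      Set.ncard_image_of_injective _ ResidueCell.toSet_injective, h.ncard_eq]
  refine ⟨⟨?_, ?_, ?_⟩, ?_⟩
  · rintro S ⟨hS, hcard⟩
    obtain ⟨T, hT, rfl⟩ := IntervalCell.isDecomposition_iff.1 hS
    obtain ⟨T', h⟩ := hT.exists_corr (N := ResidueCell)
    rw [Phi_image_of_corr h]
    exact ⟨ResidueCell.isNECS_iff.2 ⟨T', h.symm.dec, rfl⟩, (hmem h).symm.trans hcard⟩
  · rintro S₁ ⟨hS₁, -⟩ S₂ ⟨hS₂, -⟩ heq
    obtain ⟨T₁, hT₁, rfl⟩ := IntervalCell.isDecomposition_iff.1 hS₁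
    obtain ⟨T₂, hT₂, rfl⟩ := IntervalCell.isDecomposition_iff.1 hS₂
    obtain ⟨T₁', h₁⟩ := hT₁.exists_corr (N := ResidueCell)
    obtain ⟨T₂', h₂⟩ := hT₂.exists_corr (N := ResidueCell)
    rw [Phi_image_of_corr h₁, Phi_image_of_corr h₂] at heq
    obtain rfl := ResidueCell.toSet_injective.image_injective heq
    -- Both decompositions correspond to the same covering system, so uniqueness is applied from the
    -- residue side.
    rw [h₁.symm.right_unique h₂.symm]
  · rintro C ⟨hC, hcard⟩
    obtain ⟨T', hT', rfl⟩ := ResidueCell.isNECS_iff.1 hC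
    obtain ⟨T, h⟩ := hT'.exists_corr (N := IntervalCell)
    exact ⟨IntervalCell.toSet '' T, ⟨IntervalCell.isDecomposition_iff.2 ⟨T, h.symm.dec, rfl⟩,
      (hmem h.symm).trans hcard⟩, Phi_image_of_corr h.symm⟩
  · rintro S ⟨hS, -⟩
    obtain ⟨T, hT, rfl⟩ := IntervalCell.isDecomposition_iff.1 hS
    obtain ⟨T', h⟩ := hT.exists_corr (N := ResidueCell)
    obtain ⟨r, hr⟩ := hT.exists_isGcd
    rw [Phi_image_of_corr h]
    exact ⟨r, IntervalCell.isDecompositionGcd hT hr,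
      ResidueCell.isNECSGcd ((h.isGcd_iff r).1 hr)⟩
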